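/- **Theorem 3.2.** *Conventions.* On an infinite chessboard, join two squares of the same colour when they share a corner; the squares of one colour are then the unit squares of a square lattice turned by $45^\circ$, squares sharing a corner being lattice unit squares sharing an edge. For $m,n\ge 0$ take a $(2m+1)\times(2n+1)$ chessboard (i.e. $2m+1$ rows and $2n+1$ columns) with black corners. The *Aztec rectangle* $AR_{m,n}$ consists of its white squares, and the *odd Aztec rectangle* $O_{m,n}$ of its black squares; each is regarded both as a lattice region and as the graph dual to it (vertices the squares, edges the pairs of squares sharing a corner). $\mathrm M(\cdot)$ denotes the number of domino tilings of a region, respectively the number of perfect matchings of a graph. Let $m$ be an odd positive integer, let $a_1,\dots,a_s\ge 0$ be integers, and put $a=\sum_{i=1}^s(a_i+1)$. Let $\ell$ be the horizontal symmetry axis of $AR_{m,m+a}$ (the *frame*) and let $\ell'$ be its translate by one lattice unit southeast, that is, the row of chessboard squares just below $\ell$. The frame has $m+a$ squares on $\ell'$; label them $1,2,\dots,m+a$ from left to right and regard the labels as coordinates on $\ell'$. For $T\subset[m+a]=\{1,\dots,m+a\}$ let $R'(m,m+a;T)$ be the graph obtained from $AR_{m,m+a}$ by deleting all vertices on $\ell'$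 whose labels are not in $T$. For each $i$ let $c_i\in\frac12\mathbb Z$ be an integer if $a_i$ is even and half an odd integer if $a_i$ is odd, and let $A_i^{(c_i)}$ be the set of $a_i+1$ consecutive integers centered at $c_i$. Assume that the sets $A_i^{(c_i)}$ are pairwise disjoint and contained in $[m+a]$. For an integer $k$ with $0\le k\le \min_i a_i$ let $$AR'_{m+k,m+k+a}\setminus O_{k,a_1-k}^{(c_1)}\cup\cdots\cup O_{k,a_s-k}^{(c_s)}$$ be the region obtained from the Aztec rectangle $AR_{m+k,m+k+a}$ concentric with the frame by removing, for each $i$, the odd Aztec rectangle $O_{k,a_i-k}$ whose center is the point of $\ell'$ with coordinate $c_i$ (so that it is symmetric about $\ell'$). *Statement.* For every integer $k$ with $1\le k\le\min_i a_i$, $$\mathrm M\bigl(AR'_{m+k,m+k+a}\setminus O_{k,a_1-k}^{(c_1)}\cup\cdots\cup O_{k,a_s-k}^{(c_s)}\bigr) =2^{\binom{k+1}{2}(s+1)+km}\,\mathrm M\bigl(AR'_{m,m+a}\setminus O_{0,a_1}^{(c_1)}\cup\cdots\cup O_{0,a_s}^{(c_s)}\bigr)$$ $$=2^{\binom{k+1}{2}(s+1)+km}\,\mathrm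 M\Bigl(R'\bigl(m,m+a;\,[m+a]\setminus(A_1^{(c_1)}\cup\cdots\cup A_s^{(c_s)})\bigr)\Bigr).$$ -/

import Mathlib

/-- A square of the infinite chessboard, recorded as `(row, column)`; rows are numbered downwards,
columns from left to right. Squares are coloured by the parity of `row + column`. -/
abbrev Cell : Type := ℤ × ℤ

/-- Two squares of the chessboard are joined when they share a corner. Restricted to the squares
of one colour, this is the square grid graph turned by 45 degrees: the squares of that colour stand
for the unit squares of a (tilted) square lattice, and two squares that share a corner stand for
two unit squares that share an edge. -/
def cornerGraph : SimpleGraph Cell where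
  Adj p q := |p.1 - q.1| = 1 ∧ |p.2 - q.2| = 1
  symm := ⟨fun p q h => ⟨by rw [abs_sub_comm]; exact h.1, by rw [abs_sub_comm]; exact h.2⟩⟩
  loopless := ⟨fun p h => by simp at h⟩

/-- The `(2h+1) × (2w+1)` chessboard whose top left corner is the square `(r, c)`. -/
noncomputable def chessboard (h w : ℕ) (r c : ℤ) : Finset Cell :=
  Finset.Icc r (r + 2 * h) ×ˢ Finset.Icc c (c + 2 * w)

/-- The Aztec rectangle `AR_{h,w}` drawn in the `(2h+1) × (2w+1)` chessboard with black corners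
whose top left corner is `(r, c)`: its white squares. -/
noncomputable def aztecRectangle (h w : ℕ) (r c : ℤ) : Finset Cell :=
  (chessboard h w r c).filter fun p => Odd ((p.1 - r) + (p.2 - c))

/-- The odd Aztec rectangle `O_{h,w}` drawn in the `(2h+1) × (2w+1)` chessboard with black corners
whose top left corner is `(r, c)`: its black squares. -/
noncomputable def oddAztecRectangle (h w : ℕ) (r c : ℤ) : Finset Cell :=
  (chessboard h w r c).filter fun p => Even ((p.1 - r) + (p.2 - c))

/-- A domino: the union of two unit squares that share an edge. -/
def IsDomino (d : Finset Cell) : Prop :=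
  ∃ p q : Cell, cornerGraph.Adj p q ∧ d = {p, q}

/-- `D` is a tiling of the region `R` by dominoes: non-overlapping dominoes with union `R`. -/
def IsDominoTiling (R : Finset Cell) (D : Finset (Finset Cell)) : Prop :=
  (∀ d ∈ D, IsDomino d) ∧ (D : Set (Finset Cell)).PairwiseDisjoint id ∧ D.biUnion id = R

/-- The number of domino tilings of a region. -/
noncomputable def numTilings (R : Finset Cell) : ℕ :=
  {D : Finset (Finset Cell) | IsDominoTiling R D}.ncard

/-- The number of perfect matchings of a graph. -/
noncomputable def numPerfectMatchings {V : Type*} (G : SimpleGraph V) : ℕ :=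
  {M : G.Subgraph | M.IsPerfectMatching}.ncard

/-- The square with label `t` on `ℓ'`, for the Aztec rectangle (the frame) of odd height `m` whose
chessboard has its top left corner at `(0, 0)`. The horizontal symmetry axis `ℓ` is row `m`;
its translate `ℓ'` one lattice unit southeast (one row down and one column to the right) is
row `m + 1`. For odd `m` the squares of the frame on `ℓ'` are in the columns `1, 3, 5, …`, and get
the labels `1, 2, 3, …`. -/
def axisSquare (m : ℕ) (t : ℤ) : Cell := (m + 1, 2 * t - 1)

/-- The vertices of `R'(m,n;T)`: those of `AR_{m,n}`, without the ones on `ℓ'` whose label is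
not in `T`. -/
noncomputable def RPrimeVertices (m n : ℕ) (T : Finset ℤ) : Finset Cell :=
  (aztecRectangle m n 0 0).filter fun p => p.1 = m + 1 → ∃ t ∈ T, p = axisSquare m t

/-- The graph `R'(m,n;T)`. -/
def RPrime (m n : ℕ) (T : Finset ℤ) : SimpleGraph {p : Cell // p ∈ RPrimeVertices m n T} :=
  cornerGraph.comap Subtype.val

/-- The window `O_{k,b-k}^{(C/2)}`: the odd Aztec rectangle `O_{k,b-k}` with centre at the point of
`ℓ'` with coordinate `C/2`, that is, in row `m + 1` and column `2 * (C/2) - 1 = C - 1`. -/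
noncomputable def window (m k b : ℕ) (C : ℤ) : Finset Cell :=
  oddAztecRectangle k (b - k) (m + 1 - k) (C - 1 - (b - k : ℕ))

/-- The set of the `b + 1` consecutive integers centred at `C/2`, where `C` has the parity
of `b`. -/
noncomputable def centredRun (b : ℕ) (C : ℤ) : Finset ℤ := Finset.Icc ((C - b) / 2) ((C + b) / 2)

/-- The total `a = ∑ i, (a i + 1)`. -/
def totalWidth {s : ℕ} (a : Fin s → ℕ) : ℕ := ∑ i, (a i + 1)

/-- The region `AR'_{m+k,m+k+a} ∖ ⋃ i, O_{k,a i-k}^{(C i/2)}`: the Aztec rectangle of height `m + k`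
and width `m + k + a`, centred around the frame `AR_{m,m+a}`, from which the windows of
height `k` are removed. -/
noncomputable def ARPrime {s : ℕ} (m k : ℕ) (a : Fin s → ℕ) (C : Fin s → ℤ) : Finset Cell :=
  aztecRectangle (m + k) (m + k + totalWidth a) (-k) (-k) \
    Finset.univ.biUnion fun i => window m k (a i) (C i)

/-! The engine is a complementation theorem for graphs cut into four-cycles ("cells"). Keep only the
four-cycles centred in odd rows and odd columns of the outer board, except those a window destroys.
Each edge of the region then lies in exactly one cell, and two cells share at most one square. A
tiling of `R` is therefore a choice, for each cell `f`, of the part `S f` that its dominoes cover,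
together with a tiling of each `S f`: this is `numTilings_eq_sum_splittings`.

Replacing every `S f` by its complement in the cell gives the splittings of a second region `R'`,
provided each square lies in as many cells as it lies in regions `R`, `R'`. Inside a four-cycle, `2
* M(S) = √2 ^ |S| * M(Sᶜ)`, and the product over all cells is `2 ^ #cells * M(R) = √2 ^ |R| * M(R')`
(`two_pow_mul_numTilings`).

Here `R` and `R'` are the regions for `k + 1` and `k`. Complementing strips the outer boundary of
the Aztec rectangle; each window loses its top and bottom rows and gains a column on either side.
Since `|R| = 2 * (#cells + m + (k + 1) * (s + 1))`, this step costs the factor `2 ^ (m + (k + 1) *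
(s + 1))`, and the exponents add up to the one claimed. At `k = 0` the windows are runs of squares
on `ℓ'`, which gives the graph `R'`. -/

/-! ### Tilings as finite sets -/

/-- The domino tilings of `R` as a finite set. -/
noncomputable def tilings (R : Finset Cell) : Finset (Finset (Finset Cell)) :=
  open Classical in R.powerset.powerset.filter (IsDominoTiling R)

theorem mem_tilings {R : Finset Cell} {D : Finset (Finset Cell)} :
    D ∈ tilings R ↔ IsDominoTiling R D := by
  classical
  simp only [tilings, Finset.mem_filter, Finset.mem_powerset, and_iff_right_iff_imp]
  intro h d hd
  rw [Finset.mem_powerset, ← h.2.2]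
  exact Finset.subset_biUnion_of_mem id hd

theorem numTilings_eq_card (R : Finset Cell) : numTilings R = (tilings R).card := by
  rw [numTilings, ← Set.ncard_coe_finset]
  congr 1
  ext D
  simp [mem_tilings]

theorem IsDomino.card_eq {d : Finset Cell} (h : IsDomino d) : d.card = 2 := by
  obtain ⟨p, q, hpq, rfl⟩ := h
  exact Finset.card_pair hpq.ne

theorem IsDominoTiling.subset {R d : Finset Cell} {D : Finset (Finset Cell)}
    (h : IsDominoTiling R D) (hd : d ∈ D) : d ⊆ R := by
  rw [← h.2.2]
  exact Finset.subset_biUnion_of_mem id hd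

theorem IsDominoTiling.eq_of_mem {R d e : Finset Cell} {D : Finset (Finset Cell)} {v : Cell}
    (h : IsDominoTiling R D) (hd : d ∈ D) (he : e ∈ D) (hvd : v ∈ d) (hve : v ∈ e) : d = e := by
  by_contra hne
  exact Finset.disjoint_left.1 (h.2.1 hd he hne) hvd hve

theorem IsDominoTiling.exists_mem {R : Finset Cell} {D : Finset (Finset Cell)} {v : Cell}
    (h : IsDominoTiling R D) (hv : v ∈ R) : ∃ d ∈ D, v ∈ d := by
  rw [← h.2.2] at hv
  simpa using hv

theorem IsDominoTiling.card_eq {R : Finset Cell} {D : Finset (Finset Cell)}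
    (h : IsDominoTiling R D) : R.card = 2 * D.card := by
  have h2 : R.card = (D.biUnion id).card := by rw [h.2.2]
  rw [h2, Finset.card_biUnion h.2.1]
  simp only [id]
  rw [Finset.sum_congr rfl fun d hd => (h.1 d hd).card_eq]
  simp [mul_comm]

/-! ### Splitting a tiling among cells -/

section Families

open Classical in
/-- The families of subsets `S f ⊆ N f` that cover every square of `R` exactly once and no other
square. -/
noncomputable def splittings {ι : Type*} [Fintype ι] (N : ι → Finset Cell) (R : Finset Cell) :
    Finset (ι → Finset Cell) :=
  (Fintype.piFinset fun f => (N f).powerset).filter fun S =>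
    ∀ v, (Finset.univ.filter fun f => v ∈ S f).card = if v ∈ R then 1 else 0

open Classical in
/-- The part of `R` covered by the dominoes of `D` that lie inside `N f`. -/
noncomputable def coveredPart {ι : Type*} (N : ι → Finset Cell) (D : Finset (Finset Cell)) (f : ι) :
    Finset Cell :=
  (D.filter (· ⊆ N f)).biUnion id

theorem mem_coveredPart {ι : Type*} {N : ι → Finset Cell} {D : Finset (Finset Cell)} {f : ι}
    {v : Cell} : v ∈ coveredPart N D f ↔ ∃ d ∈ D, d ⊆ N f ∧ v ∈ d := by
  simp [coveredPart, and_assoc]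

variable {ι : Type*} {N : ι → Finset Cell} {R : Finset Cell}

theorem eq_of_domino_subset (hN : ∀ f g, f ≠ g → (N f ∩ N g).card ≤ 1) {d : Finset Cell}
    (hd : IsDomino d) {f g : ι} (hf : d ⊆ N f) (hg : d ⊆ N g) : f = g := by
  by_contra hne
  have h1 := hN f g hne
  have h2 := Finset.card_le_card (Finset.subset_inter hf hg)
  rw [hd.card_eq] at h2
  omega

theorem exists_domino_subset (hR : ∀ p ∈ R, ∀ q ∈ R, cornerGraph.Adj p q → ∃ f, p ∈ N f ∧ q ∈ N f)
    {d : Finset Cell} (hd : IsDomino d) (hdR : d ⊆ R) : ∃ f, d ⊆ N f := by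
  obtain ⟨p, q, hpq, rfl⟩ := hd
  obtain ⟨f, hp, hq⟩ := hR p (hdR (by simp)) q (hdR (by simp)) hpq
  exact ⟨f, by simp [Finset.insert_subset_iff, hp, hq]⟩

variable [Fintype ι]

/-- A domino has two squares, so `hN` allows at most one cell around it and `hR` provides one; the
cell of the domino over `v` is the only one covering `v`. -/
theorem coveredPart_mem_splittings (hN : ∀ f g, f ≠ g → (N f ∩ N g).card ≤ 1)
    (hR : ∀ p ∈ R, ∀ q ∈ R, cornerGraph.Adj p q → ∃ f, p ∈ N f ∧ q ∈ N f)
    {D : Finset (Finset Cell)} (hD : IsDominoTiling R D) : coveredPart N D ∈ splittings N R := by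
  classical
  simp only [splittings, Finset.mem_filter, Fintype.mem_piFinset, Finset.mem_powerset]
  refine ⟨fun f v hv => ?_, fun v => ?_⟩
  · obtain ⟨d, -, hdf, hvd⟩ := mem_coveredPart.1 hv
    exact hdf hvd
  · split_ifs with hv
    · obtain ⟨d, hd, hvd⟩ := hD.exists_mem hv
      obtain ⟨f, hf⟩ := exists_domino_subset hR (hD.1 d hd) (hD.subset hd)
      rw [Finset.card_eq_one]
      refine ⟨f, ?_⟩
      ext g
      simp only [Finset.mem_filter, Finset.mem_univ, true_and, Finset.mem_singleton]
      refine ⟨fun h => ?_, fun h => h ▸ mem_coveredPart.2 ⟨d, hd, hf, hvd⟩⟩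
      obtain ⟨e, he, heg, hve⟩ := mem_coveredPart.1 h
      have := hD.eq_of_mem hd he hvd hve
      subst this
      exact eq_of_domino_subset hN (hD.1 d hd) heg hf
    · rw [Finset.card_eq_zero, Finset.filter_eq_empty_iff]
      intro f _ h
      obtain ⟨d, hd, -, hvd⟩ := mem_coveredPart.1 h
      exact hv (hD.subset hd hvd)

theorem splittings_subset {S : ι → Finset Cell} (hS : S ∈ splittings N R) (f : ι) : S f ⊆ N f := by
  classical
  simp only [splittings, Finset.mem_filter, Fintype.mem_piFinset, Finset.mem_powerset] at hS
  exact hS.1 f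

open Classical in
theorem splittings_card {S : ι → Finset Cell} (hS : S ∈ splittings N R) (v : Cell) :
    (Finset.univ.filter fun f => v ∈ S f).card = if v ∈ R then 1 else 0 := by
  classical
  simp only [splittings, Finset.mem_filter] at hS
  convert hS.2 v

theorem splittings_disjoint {S : ι → Finset Cell} (hS : S ∈ splittings N R) {f g : ι}
    (hfg : f ≠ g) : Disjoint (S f) (S g) := by
  classical
  rw [Finset.disjoint_left]
  intro v hf hg
  have h := splittings_card hS v
  have h2 : ({f, g} : Finset ι) ⊆ Finset.univ.filter fun f => v ∈ S f := by
    simp [Finset.insert_subset_iff, hf, hg]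
  have h3 := Finset.card_le_card h2
  rw [Finset.card_pair hfg] at h3
  split_ifs at h <;> omega

theorem splittings_biUnion {S : ι → Finset Cell} (hS : S ∈ splittings N R) :
    Finset.univ.biUnion S = R := by
  classical
  ext v
  have h := splittings_card hS v
  by_cases hv : v ∈ R
  · rw [if_pos hv] at h
    obtain ⟨f, hf⟩ := Finset.card_pos.1 (h ▸ Nat.one_pos)
    simp only [Finset.mem_filter, Finset.mem_univ, true_and] at hf
    simp only [Finset.mem_biUnion, Finset.mem_univ, true_and, hv, iff_true]
    exact ⟨f, hf⟩
  · rw [if_neg hv, Finset.card_eq_zero, Finset.filter_eq_empty_iff] at h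
    simpa [hv] using h

open Classical in
theorem card_tilings_fiber (hN : ∀ f g, f ≠ g → (N f ∩ N g).card ≤ 1)
    (hR : ∀ p ∈ R, ∀ q ∈ R, cornerGraph.Adj p q → ∃ f, p ∈ N f ∧ q ∈ N f)
    {S : ι → Finset Cell} (hS : S ∈ splittings N R) :
    ((tilings R).filter fun D => coveredPart N D = S).card =
      (Fintype.piFinset fun f => tilings (S f)).card := by
  -- The glued tiling remembers its pieces: a domino of `E g` inside `N f` forces `g = f`.
  have inv : ∀ E : ι → Finset (Finset Cell), (∀ f, IsDominoTiling (S f) (E f)) → ∀ f,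
      (Finset.univ.biUnion E).filter (· ⊆ N f) = E f := by
    intro E hE f
    ext d
    simp only [Finset.mem_filter, Finset.mem_biUnion, Finset.mem_univ, true_and]
    constructor
    · rintro ⟨⟨g, hg⟩, hd⟩
      have := eq_of_domino_subset hN ((hE g).1 d hg) hd
        (((hE g).subset hg).trans (splittings_subset hS g))
      exact this ▸ hg
    · exact fun hd => ⟨⟨f, hd⟩, ((hE f).subset hd).trans (splittings_subset hS f)⟩
  refine Finset.card_nbij' (fun D f => D.filter (· ⊆ N f)) (fun E => Finset.univ.biUnion E)
    ?_ ?_ ?_ ?_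
  · intro D hD
    simp only [Finset.coe_filter, Set.mem_ofPred_eq, mem_tilings] at hD
    simp only [Finset.mem_coe, Fintype.mem_piFinset, mem_tilings]
    intro f
    refine ⟨fun d hd => hD.1.1 d (Finset.mem_filter.1 hd).1, fun d hd e he => ?_, ?_⟩
    · exact hD.1.2.1 (Finset.mem_filter.1 hd).1 (Finset.mem_filter.1 he).1
    · rw [← hD.2]
      rfl
  · intro E hE
    simp only [Finset.mem_coe, Fintype.mem_piFinset, mem_tilings] at hE
    simp only [Finset.coe_filter, Set.mem_ofPred_eq, mem_tilings]
    refine ⟨⟨?_, ?_, ?_⟩, ?_⟩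
    · intro d hd
      obtain ⟨f, -, hf⟩ := Finset.mem_biUnion.1 hd
      exact (hE f).1 d hf
    · intro d hd e he hne
      obtain ⟨f, -, hf⟩ := Finset.mem_biUnion.1 hd
      obtain ⟨g, -, hg⟩ := Finset.mem_biUnion.1 he
      by_cases hfg : f = g
      · subst hfg
        exact (hE f).2.1 hf hg hne
      · exact Finset.disjoint_of_subset_left ((hE f).subset hf)
          (Finset.disjoint_of_subset_right ((hE g).subset hg) (splittings_disjoint hS hfg))
    · rw [Finset.biUnion_biUnion, ← splittings_biUnion hS]
      exact Finset.biUnion_congr rfl fun f _ => (hE f).2.2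
    · funext f
      rw [coveredPart, ← (hE f).2.2]
      congr 1
      convert inv E hE f
  · intro D hD
    simp only [Finset.coe_filter, Set.mem_ofPred_eq, mem_tilings] at hD
    ext d
    simp only [Finset.mem_biUnion, Finset.mem_univ, true_and, Finset.mem_filter]
    refine ⟨fun ⟨_, h, _⟩ => h, fun h => ?_⟩
    obtain ⟨f, hf⟩ := exists_domino_subset hR (hD.1.1 d h) (hD.1.subset h)
    exact ⟨f, h, hf⟩
  · intro E hE
    simp only [Finset.mem_coe, Fintype.mem_piFinset, mem_tilings] at hE
    exact funext (inv E hE)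

theorem numTilings_eq_sum_splittings (hN : ∀ f g, f ≠ g → (N f ∩ N g).card ≤ 1)
    (hR : ∀ p ∈ R, ∀ q ∈ R, cornerGraph.Adj p q → ∃ f, p ∈ N f ∧ q ∈ N f) :
    numTilings R = ∑ S ∈ splittings N R, ∏ f, numTilings (S f) := by
  classical
  rw [numTilings_eq_card, Finset.card_eq_sum_card_fiberwise (f := coveredPart N)
    (t := splittings N R) fun D hD => coveredPart_mem_splittings hN hR (mem_tilings.1 hD)]
  refine Finset.sum_congr rfl fun S hS => ?_
  rw [card_tilings_fiber hN hR hS, Fintype.card_piFinset]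
  simp only [numTilings_eq_card]

end Families

/-! ### Tilings of subsets of a four-cycle -/

theorem numTilings_of_odd {S : Finset Cell} (h : Odd S.card) : numTilings S = 0 := by
  rw [numTilings_eq_card, Finset.card_eq_zero, Finset.eq_empty_iff_forall_notMem]
  intro D hD
  rw [(mem_tilings.1 hD).card_eq] at h
  exact (Nat.not_odd_iff_even.2 (even_two_mul _)) h

theorem numTilings_empty : numTilings ∅ = 1 := by
  rw [numTilings_eq_card, Finset.card_eq_one]
  refine ⟨∅, ?_⟩
  ext D
  rw [mem_tilings, Finset.mem_singleton]
  constructor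
  · intro h
    have := h.card_eq
    simpa using this
  · rintro rfl
    exact ⟨by simp, by simp, by simp⟩

open Classical in
theorem numTilings_of_card_eq_two {S : Finset Cell} (h : S.card = 2) :
    numTilings S = if IsDomino S then 1 else 0 := by
  have key : ∀ D, IsDominoTiling S D → D = {S} ∧ IsDomino S := by
    intro D hD
    have h1 : D.card = 1 := by have := hD.card_eq; omega
    obtain ⟨d, rfl⟩ := Finset.card_eq_one.1 h1
    have h2 : d = S := by simpa using hD.2.2
    subst h2
    exact ⟨rfl, hD.1 d (by simp)⟩
  rw [numTilings_eq_card]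
  split_ifs with hS
  · rw [Finset.card_eq_one]
    refine ⟨{S}, ?_⟩
    ext D
    rw [mem_tilings, Finset.mem_singleton]
    refine ⟨fun hD => (key D hD).1, ?_⟩
    rintro rfl
    exact ⟨by simpa using hS, by simp, by simp⟩
  · rw [Finset.card_eq_zero, Finset.eq_empty_iff_forall_notMem]
    exact fun D hD => hS (key D (mem_tilings.1 hD)).2

/-- The four squares that share a side with the square `f`: a four-cycle of `cornerGraph`. -/
def sideNeighbors (f : Cell) : Finset Cell :=
  {(f.1 - 1, f.2), (f.1 + 1, f.2), (f.1, f.2 - 1), (f.1, f.2 + 1)}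

theorem mem_sideNeighbors {f v : Cell} : v ∈ sideNeighbors f ↔
    ((v.1 = f.1 - 1 ∨ v.1 = f.1 + 1) ∧ v.2 = f.2) ∨
      (v.1 = f.1 ∧ (v.2 = f.2 - 1 ∨ v.2 = f.2 + 1)) := by
  simp only [sideNeighbors, Finset.mem_insert, Finset.mem_singleton, Prod.ext_iff]
  tauto

theorem card_sideNeighbors (f : Cell) : (sideNeighbors f).card = 4 := by
  rw [sideNeighbors, Finset.card_insert_of_notMem, Finset.card_insert_of_notMem,
    Finset.card_insert_of_notMem, Finset.card_singleton] <;>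
  simp [Prod.ext_iff] <;> omega

theorem cornerGraph_adj_iff {p q : Cell} : cornerGraph.Adj p q ↔
    (p.1 - q.1 = 1 ∨ p.1 - q.1 = -1) ∧ (p.2 - q.2 = 1 ∨ p.2 - q.2 = -1) := by
  simp only [cornerGraph]
  rw [abs_eq zero_le_one, abs_eq zero_le_one]

/-- The domino formed by the side neighbours of `f` in the directions `e` and `e'`. -/
def cornerDomino (f : Cell) (e e' : ℤ) : Finset Cell := {(f.1 + e, f.2), (f.1, f.2 + e')}

theorem isDomino_cornerDomino (f : Cell) {e e' : ℤ} (he : e = 1 ∨ e = -1) (he' : e' = 1 ∨ e' = -1) :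
    IsDomino (cornerDomino f e e') := by
  refine ⟨_, _, ?_, rfl⟩
  rw [cornerGraph_adj_iff]
  simp only
  omega

theorem sideNeighbors_sdiff_cornerDomino (f : Cell) {e e' : ℤ} (he : e = 1 ∨ e = -1)
    (he' : e' = 1 ∨ e' = -1) :
    sideNeighbors f \ cornerDomino f e e' = cornerDomino f (-e) (-e') := by
  ext v
  simp only [Finset.mem_sdiff, mem_sideNeighbors, cornerDomino, Finset.mem_insert,
    Finset.mem_singleton, Prod.ext_iff]
  omega

theorem exists_eq_cornerDomino {f : Cell} {d : Finset Cell} (hd : IsDomino d)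
    (hf : d ⊆ sideNeighbors f) :
    ∃ e e' : ℤ, (e = 1 ∨ e = -1) ∧ (e' = 1 ∨ e' = -1) ∧ d = cornerDomino f e e' := by
  obtain ⟨p, q, hpq, rfl⟩ := hd
  have hp := mem_sideNeighbors.1 (hf (Finset.mem_insert_self p _))
  have hq := mem_sideNeighbors.1 (hf (Finset.mem_insert_of_mem (Finset.mem_singleton_self q)))
  rw [cornerGraph_adj_iff] at hpq
  by_cases h : p.2 = f.2
  · refine ⟨p.1 - f.1, q.2 - f.2, by omega, by omega, ?_⟩
    ext v
    simp only [cornerDomino, Finset.mem_insert, Finset.mem_singleton, Prod.ext_iff]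
    omega
  · refine ⟨q.1 - f.1, p.2 - f.2, by omega, by omega, ?_⟩
    ext v
    simp only [cornerDomino, Finset.mem_insert, Finset.mem_singleton, Prod.ext_iff]
    omega

theorem isDominoTiling_pair {f : Cell} {e e' : ℤ} (he : e = 1 ∨ e = -1) (he' : e' = 1 ∨ e' = -1) :
    IsDominoTiling (sideNeighbors f) {cornerDomino f e e', cornerDomino f (-e) (-e')} := by
  refine ⟨?_, ?_, ?_⟩
  · simp only [Finset.mem_insert, Finset.mem_singleton, forall_eq_or_imp, forall_eq]
    exact ⟨isDomino_cornerDomino f he he', isDomino_cornerDomino f (by omega) (by omega)⟩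
  · rw [← sideNeighbors_sdiff_cornerDomino f he he', Finset.coe_pair]
    rintro x (rfl | rfl) y (rfl | rfl) hne
    exacts [absurd rfl hne, Finset.disjoint_sdiff, Finset.sdiff_disjoint, absurd rfl hne]
  · ext v
    simp only [Finset.biUnion_insert, Finset.singleton_biUnion, id, Finset.mem_union,
      cornerDomino, mem_sideNeighbors, Finset.mem_insert, Finset.mem_singleton, Prod.ext_iff]
    omega

theorem numTilings_sideNeighbors (f : Cell) : numTilings (sideNeighbors f) = 2 := by
  rw [numTilings_eq_card, Finset.card_eq_two]
  refine ⟨{cornerDomino f 1 1, cornerDomino f (-1) (-1)},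
    -- The form `- -1` matches `isDominoTiling_pair` at `e' = -1`.
    {cornerDomino f 1 (-1), cornerDomino f (-1) (- -1)}, ?_, ?_⟩
  · intro h
    have h1 : cornerDomino f 1 1 ∈ ({cornerDomino f 1 (-1), cornerDomino f (-1) (- -1)} :
        Finset (Finset Cell)) := h ▸ Finset.mem_insert_self _ _
    simp only [Finset.mem_insert, Finset.mem_singleton] at h1
    rcases h1 with h1 | h1
    · have h2 : (f.1, f.2 + 1) ∈ cornerDomino f 1 (-1) := h1 ▸ by simp [cornerDomino]
      simp only [cornerDomino, Finset.mem_insert, Finset.mem_singleton, Prod.ext_iff] at h2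
      omega
    · have h2 : (f.1 + 1, f.2) ∈ cornerDomino f (-1) (- -1) := h1 ▸ by simp [cornerDomino]
      simp only [cornerDomino, Finset.mem_insert, Finset.mem_singleton, Prod.ext_iff] at h2
      omega
  · ext D
    rw [mem_tilings, Finset.mem_insert, Finset.mem_singleton]
    constructor
    · intro hD
      have hcard : D.card = 2 := by
        have := hD.card_eq
        rw [card_sideNeighbors] at this
        omega
      -- The domino over the lower neighbour has `e = 1`; only `e'` is free, and the other domino is
      -- its complement.
      obtain ⟨d, hd, hvd⟩ := hD.exists_mem (v := (f.1 + 1, f.2)) (by simp [mem_sideNeighbors])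
      obtain ⟨c, hc⟩ : ∃ c, D.erase d = {c} := by
        rw [← Finset.card_eq_one, Finset.card_erase_of_mem hd, hcard]
      have hDc : D = {d, c} := by rw [← Finset.insert_erase hd, hc]
      have hdc : d ≠ c := by
        intro h
        rw [← Finset.insert_erase hd, hc, h] at hcard
        simp at hcard
      have hc2 : c = sideNeighbors f \ d := by
        have hcD : c ∈ D := by simp [hDc]
        have hdisj : Disjoint d c := hD.2.1 hd hcD hdc
        have hU := hD.2.2
        rw [hDc] at hU
        simp only [Finset.biUnion_insert, Finset.singleton_biUnion, id] at hU
        rw [← hU, Finset.union_sdiff_cancel_left hdisj]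
      obtain ⟨e, e', he, he', rfl⟩ := exists_eq_cornerDomino (hD.1 d hd) (hD.subset hd)
      have he1 : e = 1 := by
        simp only [cornerDomino, Finset.mem_insert, Finset.mem_singleton, Prod.ext_iff] at hvd
        omega
      rw [sideNeighbors_sdiff_cornerDomino f he he'] at hc2
      subst he1
      rcases he' with rfl | rfl
      · exact Or.inl (hDc.trans (by rw [hc2]))
      · exact Or.inr (hDc.trans (by rw [hc2]))
    · rintro (rfl | rfl)
      · exact isDominoTiling_pair (by omega) (by omega)
      · exact isDominoTiling_pair (by omega) (by omega)

theorem IsDomino.sideNeighbors_sdiff {f : Cell} {d : Finset Cell} (hd : IsDomino d)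
    (hf : d ⊆ sideNeighbors f) : IsDomino (sideNeighbors f \ d) := by
  obtain ⟨e, e', he, he', rfl⟩ := exists_eq_cornerDomino hd hf
  rw [sideNeighbors_sdiff_cornerDomino f he he']
  exact isDomino_cornerDomino f (by omega) (by omega)

/-- The local form of the complementation theorem. -/
theorem two_mul_numTilings_of_subset {f : Cell} {S : Finset Cell} (hS : S ⊆ sideNeighbors f) :
    2 * (numTilings S : ℝ) = √2 ^ S.card * numTilings (sideNeighbors f \ S) := by
  classical
  have h4 := card_sideNeighbors f
  have hle := Finset.card_le_card hS
  have hc := Finset.card_sdiff_of_subset hS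
  have hsq : √2 ^ 2 = (2 : ℝ) := Real.sq_sqrt zero_le_two
  rw [h4] at hle hc
  rcases Nat.even_or_odd S.card with ⟨n, hn⟩ | hodd
  · obtain rfl | rfl | rfl : n = 0 ∨ n = 1 ∨ n = 2 := by omega
    · obtain rfl := Finset.card_eq_zero.1 hn
      rw [Finset.sdiff_empty, numTilings_sideNeighbors, numTilings_empty]
      simp
    · rw [numTilings_of_card_eq_two hn, numTilings_of_card_eq_two (by omega), hn, hsq]
      congr 2
      refine if_congr ⟨fun h => h.sideNeighbors_sdiff hS, fun h => ?_⟩ rfl rfl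
      have := h.sideNeighbors_sdiff Finset.sdiff_subset
      rwa [Finset.sdiff_sdiff_eq_self hS] at this
    · obtain rfl := Finset.eq_of_subset_of_card_le hS (by omega)
      rw [Finset.sdiff_self, numTilings_sideNeighbors, numTilings_empty, hn,
        show √2 ^ (2 + 2) = (√2 ^ 2) ^ 2 by ring, hsq]
      norm_num
  · have h2 : Odd (sideNeighbors f \ S).card := by
      rw [hc]
      obtain ⟨n, hn⟩ := hodd
      exact ⟨1 - n, by omega⟩
    rw [numTilings_of_odd hodd, numTilings_of_odd h2]
    simp

/-! ### The complementation theorem -/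

section Complement

variable {ι : Type*} [Fintype ι] {c : ι → Cell} {R R' : Finset Cell}

open Classical in
-- Of the cells around `v`, exactly one covers it if `v ∈ R` and none otherwise; by `hRR` the number
-- of remaining cells is the indicator of `R'`.
theorem sdiff_mem_splittings
    (hRR : ∀ v, (Finset.univ.filter fun f => v ∈ sideNeighbors (c f)).card =
      (if v ∈ R then 1 else 0) + if v ∈ R' then 1 else 0)
    {S : ι → Finset Cell} (hS : S ∈ splittings (fun f => sideNeighbors (c f)) R) :
    (fun f => sideNeighbors (c f) \ S f) ∈ splittings (fun f => sideNeighbors (c f)) R' := by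
  simp only [splittings, Finset.mem_filter, Fintype.mem_piFinset, Finset.mem_powerset]
  refine ⟨fun f => Finset.sdiff_subset, fun v => ?_⟩
  have h1 := hRR v
  have h2 := splittings_card hS v
  have h3 : (Finset.univ.filter fun f => v ∈ S f) ⊆
      Finset.univ.filter fun f => v ∈ sideNeighbors (c f) := fun f hf => by
    simp only [Finset.mem_filter, Finset.mem_univ, true_and] at hf ⊢
    exact splittings_subset hS f hf
  have h4 := Finset.card_sdiff_of_subset h3
  rw [h1, h2, Nat.add_sub_cancel_left] at h4
  rw [← h4]
  congr 1
  ext f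
  simp

open Classical in
/-- The complementation theorem: if the edges of `R` and of `R'` lie in the four-cycles around the
squares `c f`, and each square lies in as many of these four-cycles as it lies in regions `R`, `R'`,
then the numbers of tilings of `R` and `R'` differ by an explicit power of `√2`. -/
theorem two_pow_mul_numTilings
    (hN : ∀ f g, f ≠ g → (sideNeighbors (c f) ∩ sideNeighbors (c g)).card ≤ 1)
    (hR : ∀ p ∈ R, ∀ q ∈ R, cornerGraph.Adj p q →
      ∃ f, p ∈ sideNeighbors (c f) ∧ q ∈ sideNeighbors (c f))
    (hR' : ∀ p ∈ R', ∀ q ∈ R', cornerGraph.Adj p q →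
      ∃ f, p ∈ sideNeighbors (c f) ∧ q ∈ sideNeighbors (c f))
    (hRR : ∀ v, (Finset.univ.filter fun f => v ∈ sideNeighbors (c f)).card =
      (if v ∈ R then 1 else 0) + if v ∈ R' then 1 else 0) :
    2 ^ Fintype.card ι * (numTilings R : ℝ) = √2 ^ R.card * numTilings R' := by
  rw [numTilings_eq_sum_splittings hN hR, numTilings_eq_sum_splittings hN hR']
  push_cast
  rw [Finset.mul_sum, Finset.mul_sum]
  refine Finset.sum_nbij' (fun S f => sideNeighbors (c f) \ S f)
    (fun S f => sideNeighbors (c f) \ S f) (fun S hS => sdiff_mem_splittings hRR hS)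
    (fun S hS => sdiff_mem_splittings (fun v => by rw [hRR v, add_comm]) hS)
    (fun S hS => funext fun f => Finset.sdiff_sdiff_eq_self (splittings_subset hS f))
    (fun S hS => funext fun f => Finset.sdiff_sdiff_eq_self (splittings_subset hS f))
    fun S hS => ?_
  -- The parts partition `R`, so `√2 ^ |R|` factors over the cells and the local identity applies
  -- termwise.
  have hcard : R.card = ∑ f, (S f).card := by
    conv_lhs => rw [← splittings_biUnion hS]
    exact Finset.card_biUnion fun f _ g _ hfg => splittings_disjoint hS hfg
  rw [hcard, ← Finset.prod_pow_eq_pow_sum, ← Finset.prod_mul_distrib, ← Finset.card_univ,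
    ← Finset.prod_const, ← Finset.prod_mul_distrib]
  exact Finset.prod_congr rfl fun f _ => two_mul_numTilings_of_subset (splittings_subset hS f)

end Complement

/-! ### Counting squares and cells -/

theorem card_filter_odd_Icc (n : ℕ) (r : ℤ) :
    ((Finset.Icc r (r + 2 * n)).filter fun x => Odd (x - r)).card = n := by
  have h : ((Finset.Icc r (r + 2 * n)).filter fun x => Odd (x - r)) =
      (Finset.range n).image fun i : ℕ => r + 2 * (i : ℤ) + 1 := by
    ext x
    simp only [Finset.mem_filter, Finset.mem_Icc, Finset.mem_image, Finset.mem_range, Int.odd_iff]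
    constructor
    · intro hx
      exact ⟨((x - r) / 2).toNat, by omega, by omega⟩
    · rintro ⟨i, hi, rfl⟩
      omega
  rw [h, Finset.card_image_of_injective, Finset.card_range]
  intro i j (hij : r + 2 * (i : ℤ) + 1 = r + 2 * j + 1)
  omega

theorem card_filter_even_Icc (n : ℕ) (r : ℤ) :
    ((Finset.Icc r (r + 2 * n)).filter fun x => Even (x - r)).card = n + 1 := by
  have h : ((Finset.Icc r (r + 2 * n)).filter fun x => Even (x - r)) =
      (Finset.range (n + 1)).image fun i : ℕ => r + 2 * i := by
    ext x
    simp only [Finset.mem_filter, Finset.mem_Icc, Finset.mem_image, Finset.mem_range, Int.even_iff]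
    constructor
    · intro hx
      exact ⟨((x - r) / 2).toNat, by omega, by omega⟩
    · rintro ⟨i, hi, rfl⟩
      omega
  rw [h, Finset.card_image_of_injective, Finset.card_range]
  intro i j (hij : r + 2 * (i : ℤ) = r + 2 * j)
  omega

theorem card_aztecRectangle (h w : ℕ) (r c : ℤ) :
    (aztecRectangle h w r c).card = h * (w + 1) + (h + 1) * w := by
  have H : aztecRectangle h w r c =
      ((Finset.Icc r (r + 2 * h)).filter fun x => Odd (x - r)) ×ˢ
        ((Finset.Icc c (c + 2 * w)).filter fun x => Even (x - c)) ∪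
      ((Finset.Icc r (r + 2 * h)).filter fun x => Even (x - r)) ×ˢ
        ((Finset.Icc c (c + 2 * w)).filter fun x => Odd (x - c)) := by
    ext p
    simp only [aztecRectangle, chessboard, Finset.mem_filter, Finset.mem_union, Finset.mem_product,
      Finset.mem_Icc, Int.odd_iff, Int.even_iff]
    omega
  rw [H, Finset.card_union_of_disjoint, Finset.card_product, Finset.card_product,
    card_filter_odd_Icc, card_filter_odd_Icc, card_filter_even_Icc, card_filter_even_Icc]
  rw [Finset.disjoint_left]
  intro p hp hq
  simp only [Finset.mem_filter, Finset.mem_product, Int.odd_iff, Int.even_iff] at hp hq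
  omega

theorem card_oddAztecRectangle (h w : ℕ) (r c : ℤ) :
    (oddAztecRectangle h w r c).card = (h + 1) * (w + 1) + h * w := by
  have H : oddAztecRectangle h w r c =
      ((Finset.Icc r (r + 2 * h)).filter fun x => Even (x - r)) ×ˢ
        ((Finset.Icc c (c + 2 * w)).filter fun x => Even (x - c)) ∪
      ((Finset.Icc r (r + 2 * h)).filter fun x => Odd (x - r)) ×ˢ
        ((Finset.Icc c (c + 2 * w)).filter fun x => Odd (x - c)) := by
    ext p
    simp only [oddAztecRectangle, chessboard, Finset.mem_filter, Finset.mem_union,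
      Finset.mem_product, Finset.mem_Icc, Int.odd_iff, Int.even_iff]
    omega
  rw [H, Finset.card_union_of_disjoint, Finset.card_product, Finset.card_product,
    card_filter_odd_Icc, card_filter_odd_Icc, card_filter_even_Icc, card_filter_even_Icc]
  rw [Finset.disjoint_left]
  intro p hp hq
  simp only [Finset.mem_filter, Finset.mem_product, Int.odd_iff, Int.even_iff] at hp hq
  omega

/-- The squares of a chessboard that lie in odd rows and odd columns. They are the centres of the
four-cycles of the Aztec rectangle drawn in it. -/
noncomputable def faceCentres (h w : ℕ) (r c : ℤ) : Finset Cell :=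
  ((Finset.Icc r (r + 2 * h)).filter fun x => Odd (x - r)) ×ˢ
    (Finset.Icc c (c + 2 * w)).filter fun x => Odd (x - c)

/-- The centres of the four-cycles that lie inside the window `O_{k,b-k}^{(C/2)}`. -/
noncomputable def windowFaceCentres (m k b : ℕ) (C : ℤ) : Finset Cell :=
  ((Finset.Icc (m + 1 - k : ℤ) (m + 1 - k + 2 * k)).filter fun x : ℤ => Odd (x - (m + 1 - k))) ×ˢ
    (Finset.Icc (C - 1 - (b - k : ℕ)) (C - 1 - (b - k : ℕ) + 2 * (b - k : ℕ))).filter fun x =>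
      Even (x - (C - 1 - (b - k : ℕ)))

/-- The centres of the four-cycles of the Aztec rectangle of height `m + k` that are outside the
windows. -/
noncomputable def liveFaceCentres {s : ℕ} (m k : ℕ) (a : Fin s → ℕ) (C : Fin s → ℤ) :
    Finset Cell :=
  faceCentres (m + k) (m + k + totalWidth a) (-k) (-k) \
    Finset.univ.biUnion fun i => windowFaceCentres m k (a i) (C i)

section Windows

variable {s m k : ℕ} {a : Fin s → ℕ} {C : Fin s → ℤ}

theorem mem_aztecRectangle_iff {W : ℕ} {p : Cell} :
    p ∈ aztecRectangle (m + k) (m + k + W) (-k) (-k) ↔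
      -(k : ℤ) ≤ p.1 ∧ p.1 ≤ 2 * m + k ∧ -(k : ℤ) ≤ p.2 ∧ p.2 ≤ 2 * m + k + 2 * W ∧
        (p.1 + p.2) % 2 = 1 := by
  simp only [aztecRectangle, chessboard, Finset.mem_filter, Finset.mem_product, Finset.mem_Icc,
    Int.odd_iff]
  push_cast
  omega

/-- The corner of the window has coordinate sum `m + C - b`, which is odd; hence the black squares
of the window's board are white squares of the large board. -/
theorem mem_window_iff (hm : Odd m) {b : ℕ} {c : ℤ} (hb : k ≤ b) (hc : Even (c - b)) {p : Cell} :
    p ∈ window m k b c ↔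
      (m + 1 - k : ℤ) ≤ p.1 ∧ p.1 ≤ m + 1 + k ∧ c - 1 - b + k ≤ p.2 ∧ p.2 ≤ c - 1 + b - k ∧
        (p.1 + p.2) % 2 = 1 := by
  simp only [window, oddAztecRectangle, chessboard, Finset.mem_filter, Finset.mem_product,
    Finset.mem_Icc]
  rw [Nat.odd_iff] at hm
  rw [Int.even_iff] at hc ⊢
  push_cast [hb]
  omega

theorem mem_faceCentres_iff {W : ℕ} {p : Cell} :
    p ∈ faceCentres (m + k) (m + k + W) (-k) (-k) ↔
      -(k : ℤ) < p.1 ∧ p.1 < 2 * m + k ∧ -(k : ℤ) < p.2 ∧ p.2 < 2 * m + k + 2 * W ∧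
        (p.1 + k) % 2 = 1 ∧ (p.2 + k) % 2 = 1 := by
  simp only [faceCentres, Finset.mem_filter, Finset.mem_product, Finset.mem_Icc, Int.odd_iff]
  push_cast
  omega

/-- The row bounds are strict and the column bounds weak. A cell centred here has its upper and
lower squares in the window, and every edge of a four-cycle uses one of these two, so no edge
survives. -/
theorem mem_windowFaceCentres_iff (hm : Odd m) {b : ℕ} {c : ℤ} (hb : k ≤ b) (hc : Even (c - b))
    {p : Cell} : p ∈ windowFaceCentres m k b c ↔
      (m + 1 - k : ℤ) < p.1 ∧ p.1 < m + 1 + k ∧ c - 1 - b + k ≤ p.2 ∧ p.2 ≤ c - 1 + b - k ∧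
        (p.1 + k) % 2 = 1 ∧ (p.2 + k) % 2 = 1 := by
  simp only [windowFaceCentres, Finset.mem_filter, Finset.mem_product, Finset.mem_Icc, Int.odd_iff,
    Int.even_iff]
  rw [Nat.odd_iff] at hm
  rw [Int.even_iff] at hc
  push_cast [hb]
  omega

theorem mem_ARPrime_iff (hm : Odd m) (hka : ∀ i, k ≤ a i) (hC : ∀ i, Even (C i - a i)) {p : Cell} :
    p ∈ ARPrime m k a C ↔
      (-(k : ℤ) ≤ p.1 ∧ p.1 ≤ 2 * m + k ∧ -(k : ℤ) ≤ p.2 ∧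
        p.2 ≤ 2 * m + k + 2 * totalWidth a ∧ (p.1 + p.2) % 2 = 1) ∧
      ∀ i, ¬((m + 1 - k : ℤ) ≤ p.1 ∧ p.1 ≤ m + 1 + k ∧
        C i - 1 - a i + k ≤ p.2 ∧ p.2 ≤ C i - 1 + a i - k) := by
  rw [ARPrime, Finset.mem_sdiff, mem_aztecRectangle_iff]
  refine and_congr_right fun h => ?_
  simp only [Finset.mem_biUnion, Finset.mem_univ, true_and, not_exists]
  exact forall_congr' fun i => not_congr <| by
    rw [mem_window_iff hm (hka i) (hC i)]
    omega

theorem mem_liveFaceCentres_iff (hm : Odd m) (hka : ∀ i, k ≤ a i) (hC : ∀ i, Even (C i - a i))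
    {p : Cell} : p ∈ liveFaceCentres m k a C ↔
      (-(k : ℤ) < p.1 ∧ p.1 < 2 * m + k ∧ -(k : ℤ) < p.2 ∧
        p.2 < 2 * m + k + 2 * totalWidth a ∧ (p.1 + k) % 2 = 1 ∧ (p.2 + k) % 2 = 1) ∧
      ∀ i, ¬((m + 1 - k : ℤ) < p.1 ∧ p.1 < m + 1 + k ∧
        C i - 1 - a i + k ≤ p.2 ∧ p.2 ≤ C i - 1 + a i - k) := by
  rw [liveFaceCentres, Finset.mem_sdiff, mem_faceCentres_iff]
  refine and_congr_right fun h => ?_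
  simp only [Finset.mem_biUnion, Finset.mem_univ, true_and, not_exists]
  exact forall_congr' fun i => not_congr <| by
    rw [mem_windowFaceCentres_iff hm (hka i) (hC i)]
    omega

theorem centredRun_subset_bounds {b n : ℕ} {c : ℤ} (hc : Even (c - b))
    (h : centredRun b c ⊆ Finset.Icc 1 (n : ℤ)) : 2 ≤ c - b ∧ c + b ≤ 2 * n := by
  rw [Int.even_iff] at hc
  have h1 := h (Finset.left_mem_Icc.2 (by omega) : (c - b) / 2 ∈ _)
  have h2 := h (Finset.right_mem_Icc.2 (by omega) : (c + b) / 2 ∈ _)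
  rw [Finset.mem_Icc] at h1 h2
  omega

theorem centredRun_separated {b b' : ℕ} {c c' : ℤ} (hc : Even (c - b)) (hc' : Even (c' - b'))
    (h : Disjoint (centredRun b c) (centredRun b' c')) : c + b < c' - b' ∨ c' + b' < c - b := by
  rw [Int.even_iff] at hc hc'
  by_contra! hn
  have key : ∀ t, ¬(t ∈ centredRun b c ∧ t ∈ centredRun b' c') :=
    fun t ht => Finset.disjoint_left.1 h ht.1 ht.2
  simp only [centredRun, Finset.mem_Icc] at key
  -- Two integer intervals meet exactly when one contains the left endpoint of the other.
  have h1 := key ((c - b) / 2)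
  have h2 := key ((c' - b') / 2)
  omega

theorem card_ARPrime (hm : Odd m) (hka : ∀ i, k ≤ a i) (hC : ∀ i, Even (C i - a i))
    (hframe : ∀ i, 2 ≤ C i - a i ∧ C i + a i ≤ 2 * (m + totalWidth a : ℕ))
    (hsep : ∀ i j, i ≠ j → C i + a i < C j - a j ∨ C j + a j < C i - a i) :
    (ARPrime m k a C).card + ∑ i, ((k + 1) * (a i - k + 1) + k * (a i - k)) =
      (m + k) * (m + k + totalWidth a + 1) + (m + k + 1) * (m + k + totalWidth a) := by
  have h1 : (Finset.univ.biUnion fun i => window m k (a i) (C i)) ⊆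
      aztecRectangle (m + k) (m + k + totalWidth a) (-k) (-k) := by
    intro p hp
    obtain ⟨i, -, hi⟩ := Finset.mem_biUnion.1 hp
    rw [mem_window_iff hm (hka i) (hC i)] at hi
    rw [mem_aztecRectangle_iff]
    have := hframe i
    have := hka i
    have := hm.pos
    push_cast at *
    omega
  have h2 := Finset.card_sdiff_add_card_eq_card h1
  rw [card_aztecRectangle, Finset.card_biUnion] at h2
  · rw [← h2]
    congr 1
    exact Finset.sum_congr rfl fun i _ => (card_oddAztecRectangle _ _ _ _).symm
  · intro i _ j _ hij
    rw [Function.onFun, Finset.disjoint_left]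
    intro p hp hq
    rw [mem_window_iff hm (hka _) (hC _)] at hp hq
    have := hsep i j hij
    omega

theorem card_liveFaceCentres (hm : Odd m) (hka : ∀ i, k ≤ a i) (hC : ∀ i, Even (C i - a i))
    (hframe : ∀ i, 2 ≤ C i - a i ∧ C i + a i ≤ 2 * (m + totalWidth a : ℕ))
    (hsep : ∀ i j, i ≠ j → C i + a i < C j - a j ∨ C j + a j < C i - a i) :
    (liveFaceCentres m k a C).card + ∑ i, k * (a i - k + 1) =
      (m + k) * (m + k + totalWidth a) := by
  have h1 : (Finset.univ.biUnion fun i => windowFaceCentres m k (a i) (C i)) ⊆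
      faceCentres (m + k) (m + k + totalWidth a) (-k) (-k) := by
    intro p hp
    obtain ⟨i, -, hi⟩ := Finset.mem_biUnion.1 hp
    rw [mem_windowFaceCentres_iff hm (hka i) (hC i)] at hi
    rw [mem_faceCentres_iff]
    have := hframe i
    have := hka i
    have := hm.pos
    push_cast at *
    omega
  have h2 := Finset.card_sdiff_add_card_eq_card h1
  rw [Finset.card_biUnion] at h2
  · have h3 : (faceCentres (m + k) (m + k + totalWidth a) (-k) (-k)).card =
        (m + k) * (m + k + totalWidth a) := by
      rw [faceCentres, Finset.card_product, card_filter_odd_Icc, card_filter_odd_Icc]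
    rw [← h3, ← h2]
    congr 1
    refine Finset.sum_congr rfl fun i _ => ?_
    rw [windowFaceCentres, Finset.card_product, card_filter_odd_Icc, card_filter_even_Icc]
  · intro i _ j _ hij
    rw [Function.onFun, Finset.disjoint_left]
    intro p hp hq
    rw [mem_windowFaceCentres_iff hm (hka _) (hC _)] at hp hq
    have := hsep i j hij
    omega

/-- In squares minus twice cells, the full rectangle contributes `2 * (m + k) + totalWidth a` and
each window takes away `a i - 2 * k + 1`. As `totalWidth a` is the sum of the `a i + 1`, what
remains is `2 * m + 2 * k + 2 * k * s`. -/
theorem card_ARPrime_eq (hm : Odd m) (hka : ∀ i, k ≤ a i) (hC : ∀ i, Even (C i - a i))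
    (hframe : ∀ i, 2 ≤ C i - a i ∧ C i + a i ≤ 2 * (m + totalWidth a : ℕ))
    (hsep : ∀ i j, i ≠ j → C i + a i < C j - a j ∨ C j + a j < C i - a i) :
    (ARPrime m k a C).card = 2 * ((liveFaceCentres m k a C).card + (m + k * (s + 1))) := by
  have h1 := card_ARPrime hm hka hC hframe hsep
  have h2 := card_liveFaceCentres hm hka hC hframe hsep
  -- Writing `a i = n i + k` removes the truncated subtractions.
  obtain ⟨n, rfl⟩ : ∃ n : Fin s → ℕ, a = fun i => n i + k :=
    ⟨fun i => a i - k, funext fun i => (Nat.sub_add_cancel (hka i)).symm⟩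
  have h3 : totalWidth (fun i => n i + k) = ∑ i, n i + s * (k + 1) := by
    simp [totalWidth, Finset.sum_add_distrib]
    ring
  rw [h3] at h1 h2
  simp only [Nat.add_sub_cancel, Finset.sum_add_distrib, ← Finset.mul_sum, Finset.sum_const,
    Finset.card_univ, Fintype.card_fin, smul_eq_mul] at h1 h2
  zify at h1 h2 ⊢
  linear_combination h1 - 2 * h2

open Classical in
theorem card_filter_mem_sideNeighbors (K : Finset Cell) (v : Cell) :
    (Finset.univ.filter fun f : {f // f ∈ K} => v ∈ sideNeighbors f.1).card =
      (if (v.1 - 1, v.2) ∈ K then 1 else 0) + (if (v.1 + 1, v.2) ∈ K then 1 else 0) +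
        (if (v.1, v.2 - 1) ∈ K then 1 else 0) + if (v.1, v.2 + 1) ∈ K then 1 else 0 := by
  have h : (Finset.univ.filter fun f : {f // f ∈ K} => v ∈ sideNeighbors f.1).card =
      ((sideNeighbors v).filter (· ∈ K)).card := by
    refine Finset.card_bij (fun f _ => f.1) ?_ (fun f _ g _ h => Subtype.ext h) ?_
    · intro f hf
      simp only [Finset.mem_filter, Finset.mem_univ, true_and, mem_sideNeighbors] at hf ⊢
      exact ⟨by omega, f.2⟩
    · intro f hf
      simp only [Finset.mem_filter, mem_sideNeighbors] at hf
      refine ⟨⟨f, hf.2⟩, ?_, rfl⟩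
      simp only [Finset.mem_filter, Finset.mem_univ, true_and, mem_sideNeighbors]
      omega
  rw [h, Finset.card_filter, sideNeighbors, Finset.sum_insert, Finset.sum_insert,
    Finset.sum_insert, Finset.sum_singleton]
  · ring
  all_goals
    simp [Prod.ext_iff]
  all_goals omega

end Windows

/-- By parity only one opposite pair of neighbours of a square can be cell centres. Two indicator
sums agree once the conjunctions and the disjunctions agree, so it need not be decided which summand
matches which. -/
theorem sum_ite_eq_of_iff {P₁ P₂ P₃ P₄ Q R : Prop} [Decidable P₁] [Decidable P₂] [Decidable P₃]
    [Decidable P₄] [Decidable Q] [Decidable R] (h : ((¬P₃ ∧ ¬P₄) ∧ (P₁ ∧ P₂ ↔ Q ∧ R) ∧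
      (P₁ ∨ P₂ ↔ Q ∨ R)) ∨ ((¬P₁ ∧ ¬P₂) ∧ (P₃ ∧ P₄ ↔ Q ∧ R) ∧ (P₃ ∨ P₄ ↔ Q ∨ R))) :
    ((if P₁ then 1 else 0) + (if P₂ then 1 else 0) + (if P₃ then 1 else 0) +
      if P₄ then 1 else 0 : ℕ) = (if Q then 1 else 0) + if R then 1 else 0 := by
  rcases h with ⟨⟨h1, h2⟩, h⟩ | ⟨⟨h1, h2⟩, h⟩
  · by_cases hA : P₁ <;> by_cases hB : P₂ <;> by_cases hP : Q <;> by_cases hQ : R <;> simp_all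
  · by_cases hA : P₃ <;> by_cases hB : P₄ <;> by_cases hP : Q <;> by_cases hQ : R <;> simp_all

section
variable {s m k : ℕ} {a : Fin s → ℕ} {C : Fin s → ℤ}

set_option maxHeartbeats 1000000 in
open Classical in
-- The covering hypothesis of the complementation theorem. An interior square has two cells and lies
-- in both regions; one on the outer boundary has one cell and lies only in the larger region. At a
-- window, squares dropped from its top and bottom rows lie only in the region for `k`, those it
-- gains at the sides only in the region for `k + 1`.
theorem card_liveFaceCentres_around (hm : Odd m) (hka : ∀ i, k + 1 ≤ a i)
    (hC : ∀ i, Even (C i - a i))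
    (hframe : ∀ i, 2 ≤ C i - a i ∧ C i + a i ≤ 2 * (m + totalWidth a : ℕ))
    (hsep : ∀ i j, i ≠ j → C i + a i < C j - a j ∨ C j + a j < C i - a i) (x y : ℤ) :
    (if (x - 1, y) ∈ liveFaceCentres m (k + 1) a C then 1 else 0) +
        (if (x + 1, y) ∈ liveFaceCentres m (k + 1) a C then 1 else 0) +
        (if (x, y - 1) ∈ liveFaceCentres m (k + 1) a C then 1 else 0) +
        (if (x, y + 1) ∈ liveFaceCentres m (k + 1) a C then 1 else 0) =
      (if (x, y) ∈ ARPrime m (k + 1) a C then 1 else 0) +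
        if (x, y) ∈ ARPrime m k a C then 1 else 0 := by
  have hka' : ∀ i, k ≤ a i := fun i => (Nat.le_succ k).trans (hka i)
  have hpos := hm.pos
  have hm2 := Nat.odd_iff.1 hm
  -- The window for `k` is the wider one. Outside all its column ranges no window matters; inside
  -- one, `hsep` keeps the other windows away from columns `y - 1` to `y + 1`.
  by_cases hnear : ∃ i, C i - 1 - a i + k ≤ y ∧ y ≤ C i - 1 + a i - k
  · obtain ⟨i, hi⟩ := hnear
    have hone : ∀ (P : Fin s → Prop), (∀ j, j ≠ i → ¬P j) → ((∀ j, ¬P j) ↔ ¬P i) :=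
      fun P hP => ⟨fun h => h i, fun h j => by
        rcases eq_or_ne j i with rfl | hj
        exacts [h, hP j hj]⟩
    have hlive : ∀ x' y' : ℤ, y - 1 ≤ y' ∧ y' ≤ y + 1 → _ := fun x' y' hy' =>
      (mem_liveFaceCentres_iff hm hka hC (p := (x', y'))).trans <| and_congr_right fun _ =>
        hone _ fun j hj => by have := hsep j i hj; push_cast; omega
    have hR := (mem_ARPrime_iff hm hka hC (p := (x, y))).trans <| and_congr_right fun _ =>
      hone _ fun j hj => by have := hsep j i hj; push_cast; omega
    have hR' := (mem_ARPrime_iff hm hka' hC (p := (x, y))).trans <| and_congr_right fun _ =>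
      hone _ fun j hj => by have := hsep j i hj; omega
    simp only [hlive (x - 1) y (by omega), hlive (x + 1) y (by omega), hlive x (y - 1) (by omega),
      hlive x (y + 1) (by omega), hR, hR']
    have hfi := hframe i
    have hCi := Int.even_iff.1 (hC i)
    have hki := hka i
    clear hone hlive hR hR' hsep hframe hka hka' hC
    push_cast at *
    apply sum_ite_eq_of_iff
    rcases Int.emod_two_eq_zero_or_one (y + k) with hy | hy
    · refine Or.inl ⟨⟨by omega, by omega⟩, ⟨?_, ?_⟩, ?_, ?_⟩ <;> omega
    · refine Or.inr ⟨⟨by omega, by omega⟩, ⟨?_, ?_⟩, ?_, ?_⟩ <;> omega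
  · push Not at hnear
    have hlive : ∀ x' y' : ℤ, y - 1 ≤ y' ∧ y' ≤ y + 1 → _ := fun x' y' hy' =>
      (mem_liveFaceCentres_iff hm hka hC (p := (x', y'))).trans <| and_iff_left <| fun j => by
        have := hnear j; push_cast; omega
    have hR := (mem_ARPrime_iff hm hka hC (p := (x, y))).trans <| and_iff_left <| fun j => by
      have := hnear j; push_cast; omega
    have hR' := (mem_ARPrime_iff hm hka' hC (p := (x, y))).trans <| and_iff_left <| fun j => by
      have := hnear j; omega
    simp only [hlive (x - 1) y (by omega), hlive (x + 1) y (by omega), hlive x (y - 1) (by omega),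
      hlive x (y + 1) (by omega), hR, hR']
    clear hlive hR hR' hsep hframe hka hka' hC hnear
    push_cast at *
    apply sum_ite_eq_of_iff
    rcases Int.emod_two_eq_zero_or_one (y + k) with hy | hy
    · refine Or.inl ⟨⟨by omega, by omega⟩, ⟨?_, ?_⟩, ?_, ?_⟩ <;> omega
    · refine Or.inr ⟨⟨by omega, by omega⟩, ⟨?_, ?_⟩, ?_, ?_⟩ <;> omega
end

/-! ### The step from `k + 1` to `k`, and the base case -/

section Step

variable {s m k : ℕ} {a : Fin s → ℕ} {C : Fin s → ℤ}

theorem exists_liveFaceCentre_of_adj (hm : Odd m) (hka : ∀ i, k + 1 ≤ a i)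
    (hC : ∀ i, Even (C i - a i)) {p q : Cell} (hpq : cornerGraph.Adj p q)
    (h : (p ∈ ARPrime m (k + 1) a C ∧ q ∈ ARPrime m (k + 1) a C) ∨
      (p ∈ ARPrime m k a C ∧ q ∈ ARPrime m k a C)) :
    ∃ f ∈ liveFaceCentres m (k + 1) a C, p ∈ sideNeighbors f ∧ q ∈ sideNeighbors f := by
  have hka' : ∀ i, k ≤ a i := fun i => (Nat.le_succ k).trans (hka i)
  rw [cornerGraph_adj_iff] at hpq
  simp only [mem_ARPrime_iff hm hka hC, mem_ARPrime_iff hm hka' hC] at h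
  push_cast at h
  rcases Int.emod_two_eq_zero_or_one (p.1 + k) with hp | hp
  · refine ⟨(p.1, q.2), ?_, ?_, ?_⟩
    · rw [mem_liveFaceCentres_iff hm hka hC]
      push_cast
      refine ⟨by omega, fun i hi => ?_⟩
      rcases h with ⟨⟨-, h1⟩, -, h2⟩ | ⟨⟨-, h1⟩, -, h2⟩
      · exact h2 i (by omega)
      · exact h1 i (by omega)
    · rw [mem_sideNeighbors]
      omega
    · rw [mem_sideNeighbors]
      omega
  · refine ⟨(q.1, p.2), ?_, ?_, ?_⟩
    · rw [mem_liveFaceCentres_iff hm hka hC]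
      push_cast
      refine ⟨by omega, fun i hi => ?_⟩
      rcases h with ⟨⟨-, h1⟩, -, h2⟩ | ⟨⟨-, h1⟩, -, h2⟩
      · exact h1 i (by omega)
      · exact h2 i (by omega)
    · rw [mem_sideNeighbors]
      omega
    · rw [mem_sideNeighbors]
      omega

/-- Sharing two squares requires diagonally adjacent centres, which the common parity of all centres
rules out. -/
theorem card_sideNeighbors_inter_le_one (hm : Odd m) (hka : ∀ i, k ≤ a i)
    (hC : ∀ i, Even (C i - a i)) {f g : Cell} (hf : f ∈ liveFaceCentres m k a C)
    (hg : g ∈ liveFaceCentres m k a C) (hfg : f ≠ g) :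
    (sideNeighbors f ∩ sideNeighbors g).card ≤ 1 := by
  rw [mem_liveFaceCentres_iff hm hka hC] at hf hg
  rw [Ne, Prod.ext_iff] at hfg
  rw [Finset.card_le_one]
  intro u hu v hv
  rw [Finset.mem_inter, mem_sideNeighbors, mem_sideNeighbors] at hu hv
  obtain ⟨⟨-, -, -, -, hf⟩, -⟩ := hf
  obtain ⟨⟨-, -, -, -, hg⟩, -⟩ := hg
  rw [Prod.ext_iff]
  omega

/-- Shrinking all windows by one unit, together with the Aztec rectangle around them. -/
theorem numTilings_ARPrime_succ (hm : Odd m) (hka : ∀ i, k + 1 ≤ a i)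
    (hC : ∀ i, Even (C i - a i))
    (hframe : ∀ i, 2 ≤ C i - a i ∧ C i + a i ≤ 2 * (m + totalWidth a : ℕ))
    (hsep : ∀ i j, i ≠ j → C i + a i < C j - a j ∨ C j + a j < C i - a i) :
    numTilings (ARPrime m (k + 1) a C) =
      2 ^ (m + (k + 1) * (s + 1)) * numTilings (ARPrime m k a C) := by
  classical
  have h := two_pow_mul_numTilings (ι := {f // f ∈ liveFaceCentres m (k + 1) a C})
    (c := Subtype.val) (R := ARPrime m (k + 1) a C) (R' := ARPrime m k a C)
    (fun f g hfg => card_sideNeighbors_inter_le_one hm hka hC f.2 g.2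
      fun h => hfg (Subtype.ext h))
    (fun p hp q hq hpq => by
      obtain ⟨f, hf, h⟩ := exists_liveFaceCentre_of_adj hm hka hC hpq (Or.inl ⟨hp, hq⟩)
      exact ⟨⟨f, hf⟩, h⟩)
    (fun p hp q hq hpq => by
      obtain ⟨f, hf, h⟩ := exists_liveFaceCentre_of_adj hm hka hC hpq (Or.inr ⟨hp, hq⟩)
      exact ⟨⟨f, hf⟩, h⟩)
    (fun v => by
      have h1 := card_filter_mem_sideNeighbors (liveFaceCentres m (k + 1) a C) v
      rw [card_liveFaceCentres_around hm hka hC hframe hsep] at h1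
      convert h1)
  -- The even exponent turns `√2 ^ |R|` into a power of 2, from which `2 ^ #cells` cancels.
  rw [card_ARPrime_eq hm hka hC hframe hsep, pow_mul, Real.sq_sqrt zero_le_two, pow_add,
    Fintype.card_coe, mul_assoc] at h
  exact_mod_cast mul_left_cancel₀ (by positivity) h

theorem numTilings_ARPrime_eq (hm : Odd m) (hC : ∀ i, Even (C i - a i))
    (hframe : ∀ i, 2 ≤ C i - a i ∧ C i + a i ≤ 2 * (m + totalWidth a : ℕ))
    (hsep : ∀ i j, i ≠ j → C i + a i < C j - a j ∨ C j + a j < C i - a i)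
    (k : ℕ) (hka : ∀ i, k ≤ a i) :
    numTilings (ARPrime m k a C) =
      2 ^ ((k + 1).choose 2 * (s + 1) + k * m) * numTilings (ARPrime m 0 a C) := by
  induction k with
  | zero => simp
  | succ k ih =>
    rw [numTilings_ARPrime_succ hm hka hC hframe hsep, ih fun i => (Nat.le_succ k).trans (hka i),
      ← mul_assoc, ← pow_add]
    congr 2
    rw [Nat.choose_succ_succ (k + 1) 1, Nat.choose_one_right]
    ring

theorem RPrimeVertices_eq_ARPrime (hm : Odd m) (hC : ∀ i, Even (C i - a i)) :
    RPrimeVertices m (m + totalWidth a) (Finset.Icc 1 ((m + totalWidth a : ℕ) : ℤ) \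
      Finset.univ.biUnion fun i => centredRun (a i) (C i)) = ARPrime m 0 a C := by
  ext p
  have hm2 := Nat.odd_iff.1 hm
  have haz : p ∈ aztecRectangle m (m + totalWidth a) 0 0 ↔ _ := mem_aztecRectangle_iff (k := 0)
  rw [mem_ARPrime_iff hm (fun i => Nat.zero_le _) hC, RPrimeVertices, Finset.mem_filter, haz]
  simp only [axisSquare, Finset.mem_sdiff, Finset.mem_Icc, Finset.mem_biUnion,
    Finset.mem_univ, true_and, centredRun, not_exists, Prod.ext_iff]
  push_cast
  refine and_congr_right fun hp => ⟨fun h i hi => ?_, fun h hp1 => ?_⟩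
  · obtain ⟨t, ht, ht'⟩ := h (by omega)
    have := Int.even_iff.1 (hC i)
    have := ht.2 i
    omega
  · refine ⟨(p.2 + 1) / 2, ⟨by omega, fun i hi => ?_⟩, by omega⟩
    have := Int.even_iff.1 (hC i)
    exact h i (by omega)

end Step

/-! ### Domino tilings as perfect matchings -/

section PerfectMatchings

variable {R : Finset Cell}

/-- The subgraph whose edges are the dominoes of `D`. -/
def dominoSubgraph (R : Finset Cell) (D : Finset (Finset Cell)) :
    (cornerGraph.comap (Subtype.val : {p // p ∈ R} → Cell)).Subgraph where
  verts := Set.univ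
  Adj p q := cornerGraph.Adj p.1 q.1 ∧ {p.1, q.1} ∈ D
  adj_sub h := h.1
  edge_vert _ := Set.mem_univ _
  symm := ⟨fun p q h => ⟨h.1.symm, Finset.pair_comm p.1 q.1 ▸ h.2⟩⟩

theorem pair_eq_pair_iff_of_left {p q r : Cell} :
    ({p, q} : Finset Cell) = {p, r} ↔ q = r := by
  refine ⟨fun h => ?_, fun h => by rw [h]⟩
  rw [← Finset.coe_inj] at h
  simp only [Finset.coe_pair, Set.pair_eq_pair_iff] at h
  grind

theorem isPerfectMatching_dominoSubgraph {D : Finset (Finset Cell)} (hD : IsDominoTiling R D) :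
    (dominoSubgraph R D).IsPerfectMatching := by
  rw [SimpleGraph.Subgraph.isPerfectMatching_iff]
  intro v
  obtain ⟨d, hd, hvd⟩ := hD.exists_mem v.2
  obtain ⟨w, hw, hvw, rfl⟩ : ∃ w ∈ R, cornerGraph.Adj v.1 w ∧ d = {v.1, w} := by
    have hsub := hD.subset hd
    obtain ⟨p, q, hpq, rfl⟩ := hD.1 d hd
    simp only [Finset.mem_insert, Finset.mem_singleton] at hvd
    rcases hvd with h | h
    · exact ⟨q, hsub (by simp), h ▸ hpq, by rw [h]⟩
    · exact ⟨p, hsub (by simp), h ▸ hpq.symm, by rw [h, Finset.pair_comm]⟩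
  refine ⟨⟨w, hw⟩, ⟨hvw, hd⟩, fun u hu => Subtype.ext ?_⟩
  exact pair_eq_pair_iff_of_left.1 (hD.eq_of_mem hu.2 hd (Finset.mem_insert_self _ _) hvd)

/-- Every domino of `D` is recovered as an edge. One inclusion suffices, since the other follows by
symmetry. -/
theorem dominoSubgraph_injective {D D' : Finset (Finset Cell)} (hD : IsDominoTiling R D)
    (h : dominoSubgraph R D = dominoSubgraph R D') : D ⊆ D' := by
  intro d hd
  have hsub := hD.subset hd
  obtain ⟨p, q, hpq, rfl⟩ := hD.1 d hd
  have h1 : (dominoSubgraph R D).Adj ⟨p, hsub (by simp)⟩ ⟨q, hsub (by simp)⟩ := ⟨hpq, hd⟩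
  rw [h] at h1
  exact h1.2

theorem exists_dominoSubgraph_eq
    {M : (cornerGraph.comap (Subtype.val : {p // p ∈ R} → Cell)).Subgraph}
    (hM : M.IsPerfectMatching) : ∃ D, IsDominoTiling R D ∧ dominoSubgraph R D = M := by
  classical
  let D : Finset (Finset Cell) :=
    R.powerset.filter fun d => ∃ p q, M.Adj p q ∧ d = {p.1, q.1}
  have hmem : ∀ d, d ∈ D ↔ ∃ p q, M.Adj p q ∧ d = {p.1, q.1} := by
    intro d
    simp only [D, Finset.mem_filter, Finset.mem_powerset, and_iff_right_iff_imp]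
    rintro ⟨p, q, -, rfl⟩
    simp [Finset.insert_subset_iff, p.2, q.2]
  rw [SimpleGraph.Subgraph.isPerfectMatching_iff] at hM
  have hmem' : ∀ d ∈ D, ∀ v (hv : v ∈ d), ∃ hvR : v ∈ R, ∃ w, M.Adj ⟨v, hvR⟩ w ∧ d = {v, w.1} := by
    intro d hd v hv
    obtain ⟨p, q, hpq, rfl⟩ := (hmem d).1 hd
    simp only [Finset.mem_insert, Finset.mem_singleton] at hv
    rcases hv with rfl | rfl
    · exact ⟨p.2, q, hpq, rfl⟩
    · exact ⟨q.2, p, hpq.symm, Finset.pair_comm _ _⟩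
  refine ⟨D, ⟨?_, ?_, ?_⟩, ?_⟩
  · intro d hd
    obtain ⟨p, q, hpq, rfl⟩ := (hmem d).1 hd
    exact ⟨p, q, hpq.adj_sub, rfl⟩
  · intro d hd e he hne
    refine Finset.disjoint_left.2 fun v hvd hve => hne ?_
    obtain ⟨hvR, w, hw, rfl⟩ := hmem' d hd v hvd
    obtain ⟨_, u, hu, rfl⟩ := hmem' e he v hve
    rw [(hM ⟨v, hvR⟩).unique hw hu]
  · ext v
    simp only [Finset.mem_biUnion, id]
    constructor
    · rintro ⟨d, hd, hv⟩
      exact (hmem' d hd v hv).1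
    · intro hv
      obtain ⟨w, hw, -⟩ := hM ⟨v, hv⟩
      exact ⟨{v, w.1}, (hmem _).2 ⟨_, _, hw, rfl⟩, by simp⟩
  · ext p q
    · simp only [dominoSubgraph, Set.mem_univ, true_iff]
      obtain ⟨w, hw, -⟩ := hM p
      exact hw.fst_mem
    · constructor
      · rintro ⟨-, h⟩
        obtain ⟨_, w, hw, hpw⟩ := hmem' _ h p.1 (by simp)
        rwa [Subtype.ext (pair_eq_pair_iff_of_left.1 hpw)]
      · exact fun h => ⟨h.adj_sub, (hmem _).2 ⟨p, q, h, rfl⟩⟩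

theorem numPerfectMatchings_comap_eq_numTilings (R : Finset Cell) :
    numPerfectMatchings (cornerGraph.comap (Subtype.val : {p // p ∈ R} → Cell)) =
      numTilings R := by
  refine (Set.ncard_congr (fun D _ => dominoSubgraph R D)
    (fun D hD => isPerfectMatching_dominoSubgraph hD) (fun D D' hD hD' h => ?_)
    fun M hM => ?_).symm
  · exact (dominoSubgraph_injective hD h).antisymm (dominoSubgraph_injective hD' h.symm)
  · obtain ⟨D, hD, h⟩ := exists_dominoSubgraph_eq hM
    exact ⟨D, hD, h⟩

end PerfectMatchings

/-! ### The theorem -/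

/-- `C i` is twice the coordinate `c i` on `ℓ'` of the centre of the `i`-th window; so `c i` is an
integer for even `a i` and a half-integer for odd `a i`. -/
theorem theorem3p2 (s m k : ℕ) (a : Fin s → ℕ) (C : Fin s → ℤ)
    (hm : Odd m) (hk : 0 < k) (hka : ∀ i, k ≤ a i)
    (hC : ∀ i, Even (C i - a i))
    (hframe : ∀ i, centredRun (a i) (C i) ⊆ Finset.Icc 1 ((m + totalWidth a : ℕ) : ℤ))
    (hdisj : ∀ i j, i ≠ j → Disjoint (centredRun (a i) (C i)) (centredRun (a j) (C j))) :
    numTilings (ARPrime m k a C) =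
        2 ^ ((k + 1).choose 2 * (s + 1) + k * m) * numTilings (ARPrime m 0 a C) ∧
      numTilings (ARPrime m k a C) =
        2 ^ ((k + 1).choose 2 * (s + 1) + k * m) *
          numPerfectMatchings (RPrime m (m + totalWidth a)
            (Finset.Icc 1 ((m + totalWidth a : ℕ) : ℤ) \
              Finset.univ.biUnion fun i => centredRun (a i) (C i))) := by
  have hframe' := fun i => centredRun_subset_bounds (hC i) (hframe i)
  have hsep := fun i j hij => centredRun_separated (hC i) (hC j) (hdisj i j hij)
  have h := numTilings_ARPrime_eq hm hC hframe' hsep k hka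
  refine ⟨h, ?_⟩
  rw [h, RPrime, numPerfectMatchings_comap_eq_numTilings, RPrimeVertices_eq_ARPrime hm hC]
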